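/- Let $n\ge 1$ and $m\ge 0$ be integers, let $M$ be a smooth $n$-dimensional manifold, and let $F:M\to\mathbb{R}^{m+n}$ be a smooth immersion; give $M$ the induced metric. Let $B$ be the second fundamental form, $B(X,Y)=(D_X\,dF(Y))^{\perp}$, a section of $\mathrm{Hom}(\odot^2TM,NM)$ with the connection $\nabla$ induced by the Levi-Civita connection of $TM$ and the normal connection of $NM$; let $H=\operatorname{tr}B=\sum_i B(e_i,e_i)$ be the (unnormalized) mean curvature vector, $\nabla H$ its covariant derivative in the normal bundle, and let $|\cdot|$ be the norms induced by the metrics ($|B|^2=\sum_{i,j}|B(e_i,e_j)|^2$, $|\nabla B|^2=\sum_{i,j,k}|(\nabla_{e_k}B)(e_i,e_j)|^2$, $|\nabla H|^2=\sum_k|\nabla_{e_k}H|^2$ for an orthonormal tangent frame $\{e_i\}$). Then the function $|B|$ is differentiable at every point where $B\neq 0$, and at every point of $M$ where $|B|$ is differentiable the following hold. For every real $\varepsilon>0$, $$|\nabla B|^2\ \ge\ \Bigl(1+\frac{2}{n+\varepsilon}\Bigr)\bigl|\nabla|B|\bigr|^2-C(n,\varepsilon)\,|\nabla H|^2,\qquad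 C(n,\varepsilon)=\frac{2(n-1+\varepsilon)}{\varepsilon(n+\varepsilon)}.$$ If moreover $M$ has parallel mean curvature, i.e. $\nabla H=0$ on all of $M$, then $$|\nabla B|^2\ \ge\ \Bigl(1+\frac{2}{n}\Bigr)\bigl|\nabla|B|\bigr|^2 .$$ -/

import Mathlib

open scoped Manifold ContDiff

/-- An immersed smooth `n`-dimensional submanifold of Euclidean space `ℝ^(m+n)`: a smooth map from
a smooth `n`-manifold `M` whose differential is injective at every point. -/
structure ImmersedSubmanifold (n m : ℕ) (M : Type*) [TopologicalSpace M]
    [ChartedSpace (EuclideanSpace ℝ (Fin n)) M] where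
  /-- the immersion -/
  toFun : M → EuclideanSpace ℝ (Fin (m + n))
  contMDiff : ContMDiff (𝓡 n) 𝓘(ℝ, EuclideanSpace ℝ (Fin (m + n))) ∞ toFun
  injective_deriv : ∀ p, Function.Injective (mvfderiv (𝓡 n) toFun p)

namespace ImmersedSubmanifold

noncomputable section

variable {n m : ℕ} {M : Type*} [TopologicalSpace M] [ChartedSpace (EuclideanSpace ℝ (Fin n)) M]
  (S : ImmersedSubmanifold n m M)

/-- The differential `dF_p : T_p M → ℝ^(m+n)` of the immersion. -/
def dF (p : M) : TangentSpace (𝓡 n) p →L[ℝ] EuclideanSpace ℝ (Fin (m + n)) :=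
  mvfderiv (𝓡 n) S.toFun p

/-- The tangent plane `dF_p (T_p M)` inside `ℝ^(m+n)`. Its orthogonal complement is the normal
space `N_p M`. -/
def tangentPlane (p : M) : Submodule ℝ (EuclideanSpace ℝ (Fin (m + n))) :=
  LinearMap.range (S.dF p).toLinearMap

/-- The differential as an isomorphism of `T_p M` onto the tangent plane. -/
def tangentEquiv (p : M) : TangentSpace (𝓡 n) p ≃ₗ[ℝ] S.tangentPlane p :=
  LinearEquiv.ofInjective (S.dF p).toLinearMap (S.injective_deriv p)

theorem finrank_tangentPlane (p : M) : Module.finrank ℝ (S.tangentPlane p) = n := by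
  rw [← (S.tangentEquiv p).finrank_eq]
  exact finrank_euclideanSpace_fin (𝕜 := ℝ) (n := n)

/-- The tangential part of a vector of `ℝ^(m+n)`, as an element of `T_p M`. -/
def tangentialPart (p : M) (v : EuclideanSpace ℝ (Fin (m + n))) : TangentSpace (𝓡 n) p :=
  (S.tangentEquiv p).symm ((S.tangentPlane p).orthogonalProjectionOnto v)

/-- The normal part of a vector of `ℝ^(m+n)`. -/
def normalPart (p : M) (v : EuclideanSpace ℝ (Fin (m + n))) : EuclideanSpace ℝ (Fin (m + n)) :=
  (S.tangentPlane p)ᗮ.starProjection v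

/-- A basis of `T_p M` that is orthonormal for the induced metric
`g_p (u, w) = ⟪dF_p u, dF_p w⟫`. The traces and norms below do not depend on its choice. -/
def frame (p : M) (i : Fin n) : TangentSpace (𝓡 n) p :=
  (S.tangentEquiv p).symm
    ((stdOrthonormalBasis ℝ (S.tangentPlane p)).reindex (finCongr (S.finrank_tangentPlane p)) i)

/-- The derivative at `p` in the ambient space, in the direction `u`, of the tangent vector field
`Y`, which is regarded as the `ℝ^(m+n)`-valued function `q ↦ dF_q (Y q)`. -/
def ambientDeriv (Y : (q : M) → TangentSpace (𝓡 n) q) (p : M) (u : TangentSpace (𝓡 n) p) :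
    EuclideanSpace ℝ (Fin (m + n)) :=
  mvfderiv (𝓡 n) (fun q ↦ S.dF q (Y q)) p u

/-- The Levi-Civita connection of the induced metric: `∇_u Y` is the tangential part of the
ambient derivative. -/
def tangentConnection (Y : (q : M) → TangentSpace (𝓡 n) q) (p : M) (u : TangentSpace (𝓡 n) p) :
    TangentSpace (𝓡 n) p :=
  S.tangentialPart p (S.ambientDeriv Y p u)

/-- The connection of the normal bundle: `∇_u ν` is the normal part of the ambient derivative of
the normal field `ν`. -/
def normalConnection (ν : M → EuclideanSpace ℝ (Fin (m + n))) (p : M)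
    (u : TangentSpace (𝓡 n) p) : EuclideanSpace ℝ (Fin (m + n)) :=
  S.normalPart p (mvfderiv (𝓡 n) ν p u)

variable [IsManifold (𝓡 n) ∞ M]

/-- A tangent vector field near `p` with value `w` at `p`, smooth near `p`. -/
def extendVector {p : M} (w : TangentSpace (𝓡 n) p) :
    (q : M) → TangentSpace (𝓡 n) q :=
  FiberBundle.extend (EuclideanSpace ℝ (Fin n)) w

/-- The second fundamental form `B_p (u, w) = (D_u W)^⊥`, where the vector field `W` extends `w`
(the result does not depend on the extension). -/
def secondFundamentalForm (p : M) (u w : TangentSpace (𝓡 n) p) :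
    EuclideanSpace ℝ (Fin (m + n)) :=
  S.normalPart p (S.ambientDeriv (extendVector w) p u)

/-- The covariant derivative of the second fundamental form for the connection of
`Hom(⊙²TM, NM)` induced from those of `TM` and `NM`:
`(∇_u B)(v, w) = ∇_u (B(V, W)) - B(∇_u V, w) - B(v, ∇_u W)`, where the vector fields `V` and `W`
extend `v` and `w` (the result does not depend on the extensions). -/
def nablaB (p : M) (u v w : TangentSpace (𝓡 n) p) : EuclideanSpace ℝ (Fin (m + n)) :=
  S.normalConnection
      (fun q ↦ S.secondFundamentalForm q (extendVector v q) (extendVector w q)) p u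
    - S.secondFundamentalForm p (S.tangentConnection (extendVector v) p u) w
    - S.secondFundamentalForm p v (S.tangentConnection (extendVector w) p u)

/-- The mean curvature vector, the (unnormalized) trace of the second fundamental form. -/
def meanCurvature (p : M) : EuclideanSpace ℝ (Fin (m + n)) :=
  ∑ i, S.secondFundamentalForm p (S.frame p i) (S.frame p i)

/-- The mean curvature vector is parallel in the normal bundle. -/
def HasParallelMeanCurvature : Prop :=
  ∀ (p : M) (u : TangentSpace (𝓡 n) p), S.normalConnection S.meanCurvature p u = 0

/-- The norm `|B|` of the second fundamental form. -/
def normB (p : M) : ℝ :=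
  √(∑ i, ∑ j, ‖S.secondFundamentalForm p (S.frame p i) (S.frame p j)‖ ^ 2)

/-- The squared norm `|∇B|²`. -/
def normSqNablaB (p : M) : ℝ :=
  ∑ k, ∑ i, ∑ j, ‖S.nablaB p (S.frame p k) (S.frame p i) (S.frame p j)‖ ^ 2

/-- The squared norm `|∇H|²`. -/
def normSqNablaH (p : M) : ℝ :=
  ∑ k, ‖S.normalConnection S.meanCurvature p (S.frame p k)‖ ^ 2

/-- The squared norm `|∇f|²`, for the induced metric, of the gradient of a function `f` that is
differentiable at `p`. -/
def normSqGrad (f : M → ℝ) (p : M) : ℝ :=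
  ∑ k, (mvfderiv (𝓡 n) f p (S.frame p k)) ^ 2

end

end ImmersedSubmanifold

/-!
The ambient space is flat, so by the Codazzi equations `∇B` is totally symmetric. Since
`|B| d|B|(u) = ⟨B, ∇_u B⟩`, Cauchy–Schwarz gives `(d|B|(u))² ≤ |∇_u B|²` for every `u` (at a zero
of `|B|`, a minimum, the differential vanishes). So for an orthonormal frame whose first vector
`e₀` has the direction of the gradient, `|∇|B||² ≤ |∇_{e₀} B|²`, and it remains to see that the
slice `∇_{e₀} B` carries only part of `|∇B|²`. By symmetry each of its entries outside
`(∇_{e₀} B)(e₀, e₀)` also occurs in another slice; the diagonal entries `(∇_{e_a} B)(e₀, e₀)` are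
bounded by `∇_{e_a} H` and the remaining diagonal entries of the same slice, with a Cauchy–Schwarz
inequality that gives `∇_{e_a} H` the weight `ε`. The parallel case is the limit `ε → 0`.

The frame `S.frame` need not be continuous. To differentiate `H` and `|B|²`, the form `B` is
extended by zero to the normal spaces, and its traces are taken in a fixed orthonormal basis of the
ambient space, adapted to the tangent plane at the point under consideration.
-/

/-! ### Sums over orthonormal bases -/

theorem sq_sum_sum_inner_le {ι κ W : Type*} [Fintype ι] [Fintype κ] [NormedAddCommGroup W]
    [InnerProductSpace ℝ W] (a b : ι → κ → W) :
    (∑ i, ∑ j, inner ℝ (a i j) (b i j)) ^ 2 ≤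
      (∑ i, ∑ j, ‖a i j‖ ^ 2) * ∑ i, ∑ j, ‖b i j‖ ^ 2 := by
  simp only [← Fintype.sum_prod_type']
  have hinner := abs_real_inner_le_norm
    (WithLp.toLp 2 fun x : ι × κ ↦ a x.1 x.2) (WithLp.toLp 2 fun x : ι × κ ↦ b x.1 x.2)
  rw [← sq_le_sq₀ (abs_nonneg _) (by positivity), sq_abs, mul_pow, PiLp.norm_sq_eq_of_L2,
    PiLp.norm_sq_eq_of_L2, PiLp.inner_apply] at hinner
  exact hinner

section OrthonormalTrace

open scoped TensorProduct

variable {ι κ V W : Type*} [Fintype ι] [Fintype κ] [NormedAddCommGroup V] [InnerProductSpace ℝ V]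
  [NormedAddCommGroup W] [InnerProductSpace ℝ W]

theorem sum_apply_self_orthonormalBasis_eq {F : Type*} [AddCommGroup F] [Module ℝ F]
    (e : OrthonormalBasis ι ℝ V) (e' : OrthonormalBasis κ ℝ V) (β : V →ₗ[ℝ] V →ₗ[ℝ] F) :
    ∑ i, β (e i) (e i) = ∑ j, β (e' j) (e' j) := by
  have : FiniteDimensional ℝ V := .of_basis e.toBasis
  have h : ∑ i, e i ⊗ₜ[ℝ] e i = ∑ j, e' j ⊗ₜ[ℝ] e' j :=
    (InnerProductSpace.canonicalCovariantTensor_eq_sum V e).symm.trans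
      (InnerProductSpace.canonicalCovariantTensor_eq_sum V e')
  simpa only [map_sum, TensorProduct.lift.tmul] using congrArg (TensorProduct.lift β) h

theorem sum_norm_sq_orthonormalBasis_eq (e : OrthonormalBasis ι ℝ V) (e' : OrthonormalBasis κ ℝ V)
    (L : V →ₗ[ℝ] W) : ∑ i, ‖L (e i)‖ ^ 2 = ∑ j, ‖L (e' j)‖ ^ 2 := by
  simpa only [LinearMap.compl₁₂_apply, innerₗ_apply_apply, real_inner_self_eq_norm_sq] using
    sum_apply_self_orthonormalBasis_eq e e' ((innerₗ W).compl₁₂ L L)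

theorem sum_sum_norm_sq_orthonormalBasis_eq (e : OrthonormalBasis ι ℝ V)
    (e' : OrthonormalBasis κ ℝ V) (β : V →ₗ[ℝ] V →ₗ[ℝ] W) :
    ∑ i, ∑ j, ‖β (e i) (e j)‖ ^ 2 = ∑ i, ∑ j, ‖β (e' i) (e' j)‖ ^ 2 := calc
  _ = ∑ i, ∑ j, ‖β (e i) (e' j)‖ ^ 2 :=
    Finset.sum_congr rfl fun i _ ↦ sum_norm_sq_orthonormalBasis_eq e e' (β (e i))
  _ = ∑ j, ∑ i, ‖β.flip (e' j) (e i)‖ ^ 2 := Finset.sum_comm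
  _ = ∑ j, ∑ i, ‖β.flip (e' j) (e' i)‖ ^ 2 :=
    Finset.sum_congr rfl fun j _ ↦ sum_norm_sq_orthonormalBasis_eq e e' (β.flip (e' j))
  _ = _ := Finset.sum_comm

theorem sum_sum_sum_norm_sq_orthonormalBasis_eq (e : OrthonormalBasis ι ℝ V)
    (e' : OrthonormalBasis κ ℝ V) (T : V →ₗ[ℝ] V →ₗ[ℝ] V →ₗ[ℝ] W) :
    ∑ a, ∑ i, ∑ j, ‖T (e a) (e i) (e j)‖ ^ 2 = ∑ a, ∑ i, ∑ j, ‖T (e' a) (e' i) (e' j)‖ ^ 2 := calc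
  _ = ∑ a, ∑ i, ∑ j, ‖T (e a) (e' i) (e' j)‖ ^ 2 :=
    Finset.sum_congr rfl fun a _ ↦ sum_sum_norm_sq_orthonormalBasis_eq e e' (T (e a))
  _ = ∑ i, ∑ a, ∑ j, ‖T.flip (e' i) (e a) (e' j)‖ ^ 2 := Finset.sum_comm
  _ = ∑ i, ∑ j, ∑ a, ‖(T.flip (e' i)).flip (e' j) (e a)‖ ^ 2 :=
    Finset.sum_congr rfl fun _ _ ↦ Finset.sum_comm
  _ = ∑ i, ∑ j, ∑ a, ‖(T.flip (e' i)).flip (e' j) (e' a)‖ ^ 2 :=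
    Finset.sum_congr rfl fun _ _ ↦ Finset.sum_congr rfl fun _ _ ↦
      sum_norm_sq_orthonormalBasis_eq e e' _
  _ = ∑ i, ∑ a, ∑ j, ‖T.flip (e' i) (e' a) (e' j)‖ ^ 2 :=
    Finset.sum_congr rfl fun _ _ ↦ Finset.sum_comm
  _ = _ := Finset.sum_comm

theorem sum_norm_sq_sum_orthonormalBasis_eq (e : OrthonormalBasis ι ℝ V)
    (e' : OrthonormalBasis κ ℝ V) (T : V →ₗ[ℝ] V →ₗ[ℝ] V →ₗ[ℝ] W) :
    ∑ a, ‖∑ i, T (e a) (e i) (e i)‖ ^ 2 = ∑ a, ‖∑ i, T (e' a) (e' i) (e' i)‖ ^ 2 := by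
  simp only [sum_apply_self_orthonormalBasis_eq e e']
  simpa only [LinearMap.sum_apply, LinearMap.flip_apply] using
    sum_norm_sq_orthonormalBasis_eq e e' (∑ i, (T.flip (e' i)).flip (e' i))

theorem exists_norm_eq_one_sum_sq_eq [Nontrivial V] (e : OrthonormalBasis ι ℝ V)
    (l : V →ₗ[ℝ] ℝ) : ∃ c, ‖c‖ = 1 ∧ ∑ k, l (e k) ^ 2 = l c ^ 2 := by
  have : FiniteDimensional ℝ V := .of_basis e.toBasis
  obtain ⟨g, hg⟩ : ∃ g : V, ∀ v, inner ℝ g v = l v :=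
    ⟨(InnerProductSpace.toDual ℝ V).symm l.toContinuousLinearMap, fun v ↦ by simp⟩
  have hsum : ∑ k, l (e k) ^ 2 = ‖g‖ ^ 2 := by
    simp only [← hg]
    exact e.sum_sq_inner_left g
  rcases eq_or_ne g 0 with rfl | hg0
  · obtain ⟨c, hc⟩ := exists_norm_eq V zero_le_one
    exact ⟨c, hc, by rw [hsum, ← hg, inner_zero_left, norm_zero]⟩
  · refine ⟨(‖g‖⁻¹ : ℝ) • g, norm_smul_inv_norm hg0, ?_⟩
    rw [hsum, ← hg, real_inner_smul_right, real_inner_self_eq_norm_sq, sq ‖g‖,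
      inv_mul_cancel_left₀ (norm_ne_zero_iff.2 hg0), sq]

theorem exists_orthonormalBasis_zero_eq [FiniteDimensional ℝ V] {c : V} (hc : ‖c‖ = 1) :
    ∃ (k : ℕ) (e : OrthonormalBasis (Fin (k + 1)) ℝ V), e 0 = c := by
  have : Nontrivial V := ⟨c, 0, by rintro rfl; simp at hc⟩
  obtain ⟨k, hk⟩ : ∃ k, Module.finrank ℝ V = k + 1 := Nat.exists_eq_add_one.2 Module.finrank_pos
  obtain ⟨e, he⟩ := Orthonormal.exists_orthonormalBasis_extension_of_card_eq (𝕜 := ℝ)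
    (ι := Fin (k + 1)) (v := fun _ ↦ c) (s := {0}) (by simpa using hk)
    ⟨fun _ ↦ hc, fun i j hij ↦ (hij (Subsingleton.elim i j)).elim⟩
  exact ⟨k, e, he 0 rfl⟩

end OrthonormalTrace

/-! ### Symmetric trilinear maps -/

section SymmetricTensor

variable {W : Type*} [NormedAddCommGroup W]

theorem norm_sub_sum_sq_le {ι : Type*} [Fintype ι] (h : W) (s : ι → W) {ε : ℝ} (hε : 0 < ε) :
    ‖h - ∑ i, s i‖ ^ 2 ≤ (Fintype.card ι + ε) * (‖h‖ ^ 2 / ε + ∑ i, ‖s i‖ ^ 2) := by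
  have hnorm : ‖h - ∑ i, s i‖ ≤ ‖h‖ + ∑ i, ‖s i‖ :=
    (norm_sub_le _ _).trans (add_le_add_right (norm_sum_le _ _) _)
  have hcs := Finset.sq_sum_div_le_sum_sq_div (Finset.univ : Finset (Option ι))
    (fun o ↦ o.elim ‖h‖ fun i ↦ ‖s i‖) (g := fun o ↦ o.elim ε fun _ ↦ 1)
    (by rintro (_ | _) - <;> simp [hε])
  simp only [Fintype.sum_option, Option.elim, Finset.sum_const, Finset.card_univ, nsmul_eq_mul,
    mul_one, div_one] at hcs
  rw [div_le_iff₀' (by positivity), add_comm ε] at hcs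
  exact (by gcongr : ‖h - ∑ i, s i‖ ^ 2 ≤ _).trans hcs

theorem norm_sq_zero_zero_le {k : ℕ} (t : Fin (k + 1) → Fin (k + 1) → W) {ε : ℝ} (hε : 0 < ε) :
    ‖t 0 0‖ ^ 2 ≤
      (k + ε) * (‖∑ i, t i i‖ ^ 2 / ε + ∑ i : Fin k, ∑ j : Fin k, ‖t i.succ j.succ‖ ^ 2) := by
  have htrace : t 0 0 = ∑ i, t i i - ∑ i : Fin k, t i.succ i.succ := by
    rw [Fin.sum_univ_succ, add_sub_cancel_right]
  calc ‖t 0 0‖ ^ 2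
    _ ≤ (k + ε) * (‖∑ i, t i i‖ ^ 2 / ε + ∑ i : Fin k, ‖t i.succ i.succ‖ ^ 2) := by
      simpa only [htrace, Fintype.card_fin] using
        norm_sub_sum_sq_le (∑ i, t i i) (fun i : Fin k ↦ t i.succ i.succ) hε
    _ ≤ _ := by
      gcongr with i
      exact Finset.single_le_sum (f := fun j : Fin k ↦ ‖t i.succ j.succ‖ ^ 2)
        (fun _ _ ↦ sq_nonneg _) (Finset.mem_univ i)

theorem sum_sum_norm_sq_succ_of_symm {k : ℕ} {t : Fin (k + 1) → Fin (k + 1) → W}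
    (ht : ∀ i j, t i j = t j i) :
    ∑ i, ∑ j, ‖t i j‖ ^ 2 = ‖t 0 0‖ ^ 2 + 2 * ∑ j : Fin k, ‖t 0 j.succ‖ ^ 2 +
      ∑ i : Fin k, ∑ j : Fin k, ‖t i.succ j.succ‖ ^ 2 := by
  simp only [Fin.sum_univ_succ, Finset.sum_add_distrib, ht (Fin.succ _) 0]
  ring

theorem four_mul_le_of_le_sub_one_mul_add {N y g q : ℝ} (hN : 2 ≤ N) (hy : 0 ≤ y) (hg : 0 ≤ g)
    (hq : 0 ≤ q) (hle : y ≤ (N - 1) * (g + q)) : 4 * y ≤ N * (y + q) + 2 * (N - 1) * g := by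
  rcases le_total 4 N with h4 | h4
  · nlinarith [mul_nonneg (sub_nonneg.2 h4) hy, mul_nonneg (by linarith : (0 : ℝ) ≤ N) hq,
      mul_nonneg (by linarith : (0 : ℝ) ≤ N - 1) hg]
  · -- `(4 - N) * (N - 1) ≤ N`, since `(N - 2) ^ 2 ≥ 0`
    have hle' : (4 - N) * y ≤ (4 - N) * ((N - 1) * (g + q)) := by gcongr
    nlinarith [mul_nonneg (sq_nonneg (N - 2)) hq,
      mul_nonneg (mul_nonneg (sub_nonneg.2 hN) (by linarith : (0 : ℝ) ≤ N - 1)) hg]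

theorem two_mul_sum_norm_sq_slice_zero_le {k : ℕ}
    {T : Fin (k + 1) → Fin (k + 1) → Fin (k + 1) → W}
    (hleft : ∀ a b c, T a b c = T b a c) (hright : ∀ a b c, T a b c = T a c b) {ε : ℝ}
    (hε : 0 < ε) :
    2 * ∑ i, ∑ j, ‖T 0 i j‖ ^ 2 ≤
      (k + 1 + ε) * ∑ a : Fin k, ∑ i, ∑ j, ‖T a.succ i j‖ ^ 2 +
        2 * (k + ε) / ε * ∑ a, ‖∑ i, T a i i‖ ^ 2 := by
  set x := ‖T 0 0 0‖ ^ 2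
  set y : Fin k → ℝ := fun a ↦ ‖T 0 0 a.succ‖ ^ 2
  set z : Fin k → ℝ := fun a ↦ ∑ j : Fin k, ‖T 0 a.succ j.succ‖ ^ 2
  set q : Fin k → ℝ := fun a ↦ ∑ i : Fin k, ∑ j : Fin k, ‖T a.succ i.succ j.succ‖ ^ 2
  set h₀ := ‖∑ i, T 0 i i‖ ^ 2
  set h : Fin k → ℝ := fun a ↦ ‖∑ i, T a.succ i i‖ ^ 2
  have hslice₀ : ∑ i, ∑ j, ‖T 0 i j‖ ^ 2 = x + 2 * ∑ a, y a + ∑ a, z a :=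
    sum_sum_norm_sq_succ_of_symm (hright 0)
  have hslice (a : Fin k) : ∑ i, ∑ j, ‖T a.succ i j‖ ^ 2 = y a + 2 * z a + q a := by
    rw [sum_sum_norm_sq_succ_of_symm (hright a.succ)]
    simp only [hleft a.succ 0, hright 0 a.succ 0, y, z, q]
  have hx : x ≤ (k + ε) * (h₀ / ε + ∑ a, z a) := norm_sq_zero_zero_le (T 0) hε
  have hy (a : Fin k) :
      4 * y a ≤ (k + 1 + ε) * (y a + q a) + 2 * (k + 1 + ε - 1) * (h a / ε) := by
    have hk : (1 : ℝ) ≤ k := by exact_mod_cast a.pos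
    refine four_mul_le_of_le_sub_one_mul_add (by linarith) (by positivity) (by positivity)
      (by positivity) ?_
    have hdiag := norm_sq_zero_zero_le (T a.succ) hε
    rw [hleft a.succ 0 0, hright 0 a.succ 0] at hdiag
    convert hdiag using 2
    ring
  have hysum := Finset.sum_le_sum fun a (_ : a ∈ Finset.univ) ↦ hy a
  have htrace : ∑ a, ‖∑ i, T a i i‖ ^ 2 = h₀ + ∑ a, h a := Fin.sum_univ_succ _
  rw [hslice₀, htrace, Finset.sum_congr rfl fun a _ ↦ hslice a, mul_div_assoc]
  simp only [Finset.sum_add_distrib, ← Finset.mul_sum, ← Finset.sum_div] at hysum ⊢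
  linear_combination 2 * hx + hysum

theorem one_add_two_div_mul_sum_norm_sq_slice_zero_le {k : ℕ}
    {T : Fin (k + 1) → Fin (k + 1) → Fin (k + 1) → W}
    (hleft : ∀ a b c, T a b c = T b a c) (hright : ∀ a b c, T a b c = T a c b) {ε : ℝ}
    (hε : 0 < ε) :
    (1 + 2 / (k + 1 + ε)) * ∑ i, ∑ j, ‖T 0 i j‖ ^ 2 ≤ ∑ a, ∑ i, ∑ j, ‖T a i j‖ ^ 2 +
      2 * (k + ε) / (ε * (k + 1 + ε)) * ∑ a, ‖∑ i, T a i i‖ ^ 2 := by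
  have hN : 0 < k + 1 + ε := by positivity
  have hdiv := div_le_div_of_nonneg_right (two_mul_sum_norm_sq_slice_zero_le hleft hright hε) hN.le
  rw [Fin.sum_univ_succ (fun a ↦ ∑ i, ∑ j, ‖T a i j‖ ^ 2)]
  calc _ = ∑ i, ∑ j, ‖T 0 i j‖ ^ 2 + 2 * (∑ i, ∑ j, ‖T 0 i j‖ ^ 2) / (k + 1 + ε) := by ring
    _ ≤ _ := add_le_add_right hdiv _
    _ = _ := by field_simp; ring

variable {ι V : Type*} [Fintype ι] [NormedAddCommGroup V] [InnerProductSpace ℝ V]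
  [InnerProductSpace ℝ W] {T : V →ₗ[ℝ] V →ₗ[ℝ] V →ₗ[ℝ] W} {ε : ℝ}

theorem one_add_two_div_mul_sum_norm_sq_apply_le (e : OrthonormalBasis ι ℝ V)
    (hleft : ∀ u v w, T u v w = T v u w) (hright : ∀ u v w, T u v w = T u w v) (hε : 0 < ε)
    {c : V} (hc : ‖c‖ = 1) :
    (1 + 2 / (Fintype.card ι + ε)) * ∑ i, ∑ j, ‖T c (e i) (e j)‖ ^ 2 ≤
      ∑ a, ∑ i, ∑ j, ‖T (e a) (e i) (e j)‖ ^ 2 +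
        2 * (Fintype.card ι - 1 + ε) / (ε * (Fintype.card ι + ε)) *
          ∑ a, ‖∑ i, T (e a) (e i) (e i)‖ ^ 2 := by
  have : FiniteDimensional ℝ V := .of_basis e.toBasis
  obtain ⟨k, e', rfl⟩ := exists_orthonormalBasis_zero_eq hc
  have hcard : (Fintype.card ι : ℝ) = k + 1 := by
    rw [← Module.finrank_eq_card_basis e.toBasis, Module.finrank_eq_card_basis e'.toBasis,
      Fintype.card_fin, Nat.cast_add_one]
  rw [hcard, sum_sum_norm_sq_orthonormalBasis_eq e e', sum_norm_sq_sum_orthonormalBasis_eq e e',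
    sum_sum_sum_norm_sq_orthonormalBasis_eq e e', add_sub_cancel_right]
  exact one_add_two_div_mul_sum_norm_sq_slice_zero_le
    (T := fun a i j ↦ T (e' a) (e' i) (e' j)) (fun _ _ _ ↦ hleft _ _ _)
    (fun _ _ _ ↦ hright _ _ _) hε

theorem one_add_two_div_mul_sum_sq_le [Nontrivial V] (e : OrthonormalBasis ι ℝ V)
    (hleft : ∀ u v w, T u v w = T v u w) (hright : ∀ u v w, T u v w = T u w v) (hε : 0 < ε)
    {l : V →ₗ[ℝ] ℝ} (hl : ∀ v, l v ^ 2 ≤ ∑ i, ∑ j, ‖T v (e i) (e j)‖ ^ 2) :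
    (1 + 2 / (Fintype.card ι + ε)) * ∑ k, l (e k) ^ 2 ≤
      ∑ a, ∑ i, ∑ j, ‖T (e a) (e i) (e j)‖ ^ 2 +
        2 * (Fintype.card ι - 1 + ε) / (ε * (Fintype.card ι + ε)) *
          ∑ a, ‖∑ i, T (e a) (e i) (e i)‖ ^ 2 := by
  obtain ⟨c, hc, hsum⟩ := exists_norm_eq_one_sum_sq_eq e l
  rw [hsum]
  exact (mul_le_mul_of_nonneg_left (hl c) (by positivity)).trans
    (one_add_two_div_mul_sum_norm_sq_apply_le e hleft hright hε hc)

end SymmetricTensor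

/-! ### Traces in orthonormal bases adapted to a subspace -/

section AdaptedBasis

variable {ι κ E F : Type*} [Fintype ι] [Fintype κ] [NormedAddCommGroup E] [InnerProductSpace ℝ E]
  [FiniteDimensional ℝ E] {U : Submodule ℝ E}

/-- An orthonormal basis of a subspace, completed to one of the whole space by an orthonormal basis
of the orthogonal complement. -/
noncomputable def adaptedOrthonormalBasis (b : OrthonormalBasis ι ℝ U) :
    OrthonormalBasis (ι ⊕ Fin (Module.finrank ℝ Uᗮ)) ℝ E :=
  (b.prod (stdOrthonormalBasis ℝ Uᗮ)).map U.orthogonalDecomposition.symm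

theorem adaptedOrthonormalBasis_inl (b : OrthonormalBasis ι ℝ U) (i : ι) :
    adaptedOrthonormalBasis b (Sum.inl i) = b i := by
  simp [adaptedOrthonormalBasis, Submodule.orthogonalDecomposition_symm_apply]

theorem adaptedOrthonormalBasis_inr_mem (b : OrthonormalBasis ι ℝ U)
    (j : Fin (Module.finrank ℝ Uᗮ)) : adaptedOrthonormalBasis b (Sum.inr j) ∈ Uᗮ := by
  simp [adaptedOrthonormalBasis, Submodule.orthogonalDecomposition_symm_apply]

theorem sum_apply_self_eq_of_orthogonal [AddCommGroup F] [Module ℝ F]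
    (b : OrthonormalBasis ι ℝ U) (e : OrthonormalBasis κ ℝ E) (β : E →ₗ[ℝ] E →ₗ[ℝ] F)
    (hβ : ∀ y ∈ Uᗮ, β y y = 0) : ∑ a, β (e a) (e a) = ∑ i, β (b i) (b i) := by
  rw [sum_apply_self_orthonormalBasis_eq e (adaptedOrthonormalBasis b), Fintype.sum_sum_type]
  simp only [adaptedOrthonormalBasis_inl, hβ _ (adaptedOrthonormalBasis_inr_mem b _),
    Finset.sum_const_zero, add_zero]

theorem sum_sum_norm_sq_eq_of_orthogonal [NormedAddCommGroup F] [InnerProductSpace ℝ F]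
    (b : OrthonormalBasis ι ℝ U) (e : OrthonormalBasis κ ℝ E) (β : E →ₗ[ℝ] E →ₗ[ℝ] F)
    (hleft : ∀ y ∈ Uᗮ, β y = 0) (hright : ∀ z, ∀ y ∈ Uᗮ, β z y = 0) :
    ∑ a, ∑ c, ‖β (e a) (e c)‖ ^ 2 = ∑ i, ∑ j, ‖β (b i) (b j)‖ ^ 2 := by
  rw [sum_sum_norm_sq_orthonormalBasis_eq e (adaptedOrthonormalBasis b)]
  simp [Fintype.sum_sum_type, adaptedOrthonormalBasis_inl,
    hleft _ (adaptedOrthonormalBasis_inr_mem b _), hright _ _ (adaptedOrthonormalBasis_inr_mem b _)]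

end AdaptedBasis

/-! ### The metric left inverse of an injective linear map -/

section MetricLeftInverse

open ContinuousLinearMap (adjoint)

variable {V E : Type*} [NormedAddCommGroup V] [InnerProductSpace ℝ V] [CompleteSpace V]
  [NormedAddCommGroup E] [InnerProductSpace ℝ E] [CompleteSpace E] {A : V →L[ℝ] E}

/-- The left inverse `(A† A)⁻¹ A†` of an injective linear map `A`, which is zero on the orthogonal
complement of the range of `A`. The value is junk if `A` is not injective. -/
noncomputable def metricLeftInverse (A : V →L[ℝ] E) : E →L[ℝ] V :=
  Ring.inverse (adjoint A ∘L A) ∘L adjoint A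

theorem metricLeftInverse_eq_zero {y : E} (hy : y ∈ (LinearMap.range A.toLinearMap)ᗮ) :
    metricLeftInverse A y = 0 := by
  rw [A.orthogonal_range] at hy
  rw [metricLeftInverse, ContinuousLinearMap.comp_apply, show adjoint A y = 0 from hy, map_zero]

variable [FiniteDimensional ℝ V]

theorem isUnit_adjoint_comp_self (hA : Function.Injective A) : IsUnit (adjoint A ∘L A) := by
  rw [ContinuousLinearMap.isUnit_iff_isUnit_toLinearMap, LinearMap.isUnit_iff_ker_eq_bot]
  exact LinearMap.ker_eq_bot.2 (A.adjoint_comp_self_injective_iff.2 hA)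

theorem metricLeftInverse_apply_apply (hA : Function.Injective A) (v : V) :
    metricLeftInverse A (A v) = v :=
  DFunLike.congr_fun (Ring.inverse_mul_cancel _ (isUnit_adjoint_comp_self hA)) v

theorem starProjection_range_eq (hA : Function.Injective A) (y : E) :
    (LinearMap.range A.toLinearMap).starProjection y = A (metricLeftInverse A y) := by
  obtain ⟨v, hv : A v = _⟩ := (LinearMap.range A.toLinearMap).starProjection_apply_mem y
  have horth := (LinearMap.range A.toLinearMap).sub_starProjection_mem_orthogonal y
  rw [← hv] at horth ⊢
  rw [← sub_add_cancel y (A v), map_add, metricLeftInverse_apply_apply hA,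
    metricLeftInverse_eq_zero horth, zero_add]

theorem differentiableAt_metricLeftInverse (hA : Function.Injective A) :
    DifferentiableAt ℝ (metricLeftInverse (V := V) (E := E)) A := by
  have hadj : DifferentiableAt ℝ (fun A : V →L[ℝ] E ↦ adjoint A) A :=
    ((adjoint : (V →L[ℝ] E) ≃ₗᵢ⋆[ℝ] _).toLinearEquiv.toAddEquiv.toAddMonoidHom.toRealLinearMap
      adjoint.continuous).differentiableAt
  have hcomp : DifferentiableAt ℝ (fun A : V →L[ℝ] E ↦ adjoint A ∘L A) A :=
    hadj.clm_comp differentiableAt_id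
  have hinv : DifferentiableAt ℝ Ring.inverse (adjoint A ∘L A) :=
    differentiableAt_inverse (isUnit_adjoint_comp_self hA)
  exact (hinv.comp (f := fun A : V →L[ℝ] E ↦ adjoint A ∘L A) A hcomp).clm_comp hadj

end MetricLeftInverse

/-! ### The second fundamental form of a parametrized submanifold -/

section SecondDerivative

variable {V E : Type*} [NormedAddCommGroup V] [NormedSpace ℝ V] [NormedAddCommGroup E]
  [NormedSpace ℝ E] {f : V → E} {x : V}

theorem fderiv_fderiv_symm (hf : ContDiffAt ℝ 2 f x) (v w : V) :
    fderiv ℝ (fderiv ℝ f) x v w = fderiv ℝ (fderiv ℝ f) x w v :=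
  (hf.isSymmSndFDerivAt (by simp)).eq v w

theorem differentiableAt_fderiv_fderiv (hf : ContDiffAt ℝ 3 f x) :
    DifferentiableAt ℝ (fderiv ℝ (fderiv ℝ f)) x :=
  ((hf.fderiv_right (m := 2) (by norm_num)).fderiv_right (m := 1) (by norm_num)).differentiableAt
    one_ne_zero

end SecondDerivative

section Parametrized

open scoped RealInnerProductSpace

variable {V E : Type*} [NormedAddCommGroup V] [InnerProductSpace ℝ V] [CompleteSpace V]
  [NormedAddCommGroup E] [InnerProductSpace ℝ E] [CompleteSpace E] {f : V → E} {x : V}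

/-- The left inverse of the derivative of the parametrization `f` at `x` that is zero on the normal
space. -/
noncomputable def tangentialCoord (f : V → E) (x : V) : E →L[ℝ] V :=
  metricLeftInverse (fderiv ℝ f x)

/-- The orthogonal projection onto the normal space at `x` of the parametrization `f`. -/
noncomputable def normalProj (f : V → E) (x : V) : E →L[ℝ] E :=
  ContinuousLinearMap.id ℝ E - fderiv ℝ f x ∘L tangentialCoord f x

/-- The second fundamental form of the parametrization `f`, the normal part of its second
derivative. -/
noncomputable def normalHessian (f : V → E) (x : V) : V →ₗ[ℝ] V →ₗ[ℝ] E :=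
  LinearMap.mk₂ ℝ (fun v w ↦ normalProj f x (fderiv ℝ (fderiv ℝ f) x v w))
    (by simp) (by simp) (by simp) (by simp)

/-- The covariant derivative of the second fundamental form of the parametrization `f`. The three
correction terms come from the Christoffel symbols `tangentialCoord f x (D²f v w)` and from the
derivative of `normalProj f`; they are arranged so that the total symmetry is visible. -/
noncomputable def normalCubic (f : V → E) (x : V) : V →ₗ[ℝ] V →ₗ[ℝ] V →ₗ[ℝ] E :=
  LinearMap.mk₂ ℝ (fun u v ↦
    { toFun w := normalProj f x (fderiv ℝ (fderiv ℝ (fderiv ℝ f)) x u v w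
        - fderiv ℝ (fderiv ℝ f) x u (tangentialCoord f x (fderiv ℝ (fderiv ℝ f) x v w))
        - fderiv ℝ (fderiv ℝ f) x v (tangentialCoord f x (fderiv ℝ (fderiv ℝ f) x u w))
        - fderiv ℝ (fderiv ℝ f) x w (tangentialCoord f x (fderiv ℝ (fderiv ℝ f) x u v)))
      map_add' _ _ := by simp only [map_add, map_sub, add_apply]; abel
      map_smul' _ _ := by simp [smul_sub] })
    (fun _ _ _ ↦ by ext; simp; abel) (fun _ _ _ ↦ by ext; simp [smul_sub])
    (fun _ _ _ ↦ by ext; simp; abel) (fun _ _ _ ↦ by ext; simp [smul_sub])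

/-- The second fundamental form of the parametrization `f`, extended by zero from the tangent plane
to the ambient space. -/
noncomputable def ambientForm (f : V → E) (x : V) : E →ₗ[ℝ] E →ₗ[ℝ] E :=
  (normalHessian f x).compl₁₂ (tangentialCoord f x).toLinearMap (tangentialCoord f x).toLinearMap

theorem normalProj_apply (y : E) :
    normalProj f x y = y - fderiv ℝ f x (tangentialCoord f x y) := rfl

theorem normalHessian_apply (v w : V) :
    normalHessian f x v w = normalProj f x (fderiv ℝ (fderiv ℝ f) x v w) := rfl

theorem normalCubic_apply (u v w : V) :
    normalCubic f x u v w = normalProj f x (fderiv ℝ (fderiv ℝ (fderiv ℝ f)) x u v w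
      - fderiv ℝ (fderiv ℝ f) x u (tangentialCoord f x (fderiv ℝ (fderiv ℝ f) x v w))
      - fderiv ℝ (fderiv ℝ f) x v (tangentialCoord f x (fderiv ℝ (fderiv ℝ f) x u w))
      - fderiv ℝ (fderiv ℝ f) x w (tangentialCoord f x (fderiv ℝ (fderiv ℝ f) x u v))) := rfl

theorem ambientForm_apply (y z : E) :
    ambientForm f x y z = normalHessian f x (tangentialCoord f x y) (tangentialCoord f x z) := rfl

theorem tangentialCoord_eq_zero {y : E}
    (hy : y ∈ (LinearMap.range (fderiv ℝ f x).toLinearMap)ᗮ) : tangentialCoord f x y = 0 :=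
  metricLeftInverse_eq_zero hy

theorem normalCubic_swap_left (hf : ContDiffAt ℝ 3 f x) (u v w : V) :
    normalCubic f x u v w = normalCubic f x v u w := by
  rw [normalCubic_apply, normalCubic_apply,
    fderiv_fderiv_symm (hf.fderiv_right (m := 2) (by norm_num)) u v,
    fderiv_fderiv_symm (hf.of_le (by norm_num)) u v]
  congr 1
  abel

theorem normalCubic_swap_right (hf : ContDiffAt ℝ 3 f x) (u v w : V) :
    normalCubic f x u v w = normalCubic f x u w v := by
  have hderiv (v w : V) : HasFDerivAt (fun z ↦ fderiv ℝ (fderiv ℝ f) z v w)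
      (((fderiv ℝ (fderiv ℝ (fderiv ℝ f)) x).flip v).flip w) x := by
    simpa using ((differentiableAt_fderiv_fderiv hf).hasFDerivAt.clm_apply
      (hasFDerivAt_const v x)).clm_apply (hasFDerivAt_const w x)
  have hsymm : (fun z ↦ fderiv ℝ (fderiv ℝ f) z v w) =ᶠ[nhds x]
      fun z ↦ fderiv ℝ (fderiv ℝ f) z w v := by
    filter_upwards [(hf.of_le (by norm_num : (2 : WithTop ℕ∞) ≤ 3)).eventually (by simp)]
      with z hz using fderiv_fderiv_symm hz v w
  have hthird : fderiv ℝ (fderiv ℝ (fderiv ℝ f)) x u v w =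
      fderiv ℝ (fderiv ℝ (fderiv ℝ f)) x u w v :=
    DFunLike.congr_fun ((hderiv v w).unique ((hderiv w v).congr_of_eventuallyEq hsymm)) u
  rw [normalCubic_apply, normalCubic_apply, hthird,
    fderiv_fderiv_symm (hf.of_le (by norm_num)) v w]
  congr 1
  abel

variable [FiniteDimensional ℝ V]

theorem tangentialCoord_fderiv_apply (hinj : Function.Injective (fderiv ℝ f x)) (v : V) :
    tangentialCoord f x (fderiv ℝ f x v) = v :=
  metricLeftInverse_apply_apply hinj v

theorem normalProj_fderiv_apply (hinj : Function.Injective (fderiv ℝ f x)) (v : V) :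
    normalProj f x (fderiv ℝ f x v) = 0 := by
  rw [normalProj_apply, tangentialCoord_fderiv_apply hinj, sub_self]

theorem normalProj_eq_starProjection (hinj : Function.Injective (fderiv ℝ f x)) (y : E) :
    normalProj f x y = (LinearMap.range (fderiv ℝ f x).toLinearMap)ᗮ.starProjection y := by
  rw [Submodule.starProjection_orthogonal_val, starProjection_range_eq hinj]
  rfl

theorem normalProj_normalProj (hinj : Function.Injective (fderiv ℝ f x)) (y : E) :
    normalProj f x (normalProj f x y) = normalProj f x y := by
  conv_lhs => rw [normalProj_apply y, map_sub, normalProj_fderiv_apply hinj, sub_zero]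

theorem normalProj_normalHessian (hinj : Function.Injective (fderiv ℝ f x)) (v w : V) :
    normalProj f x (normalHessian f x v w) = normalHessian f x v w :=
  normalProj_normalProj hinj _

theorem inner_normalProj_right (hinj : Function.Injective (fderiv ℝ f x)) {y : E}
    (hy : normalProj f x y = y) (z : E) : ⟪y, normalProj f x z⟫ = ⟪y, z⟫ := by
  rw [normalProj_eq_starProjection hinj] at hy ⊢
  rw [← Submodule.inner_starProjection_left_eq_right, hy]

theorem differentiableAt_tangentialCoord (hf : ContDiffAt ℝ 2 f x)
    (hinj : Function.Injective (fderiv ℝ f x)) : DifferentiableAt ℝ (tangentialCoord f) x :=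
  (differentiableAt_metricLeftInverse hinj).comp x
    ((hf.fderiv_right (m := 1) (by norm_num)).differentiableAt one_ne_zero)

theorem fderiv_tangentialCoord_apply (hf : ContDiffAt ℝ 2 f x)
    (hinj : Function.Injective (fderiv ℝ f x)) (u v : V) :
    fderiv ℝ (tangentialCoord f) x u (fderiv ℝ f x v) =
      -tangentialCoord f x (fderiv ℝ (fderiv ℝ f) x u v) := by
  have hf' : ContDiffAt ℝ 1 (fderiv ℝ f) x := hf.fderiv_right (by norm_num)
  have hinj' : ∀ᶠ z in nhds x, Function.Injective (fderiv ℝ f z) :=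
    hf'.continuousAt.eventually (ContinuousLinearMap.isOpen_injective.mem_nhds hinj)
  have hconst : (fun z ↦ tangentialCoord f z (fderiv ℝ f z v)) =ᶠ[nhds x] fun _ ↦ v := by
    filter_upwards [hinj'] with z hz using tangentialCoord_fderiv_apply hz v
  have hprod := (differentiableAt_tangentialCoord hf hinj).hasFDerivAt.clm_apply
    ((hf'.differentiableAt one_ne_zero).hasFDerivAt.clm_apply (hasFDerivAt_const v x))
  have hzero := DFunLike.congr_fun
    (hprod.unique ((hasFDerivAt_const v x).congr_of_eventuallyEq hconst)) u
  simp only [add_apply, ContinuousLinearMap.comp_apply, ContinuousLinearMap.flip_apply,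
    zero_apply, map_zero, zero_add] at hzero
  exact eq_neg_of_add_eq_zero_right hzero

theorem differentiableAt_normalHessian_apply (hf : ContDiffAt ℝ 3 f x)
    (hinj : Function.Injective (fderiv ℝ f x)) {v w : V → V} (hv : DifferentiableAt ℝ v x)
    (hw : DifferentiableAt ℝ w x) :
    DifferentiableAt ℝ (fun z ↦ normalHessian f z (v z) (w z)) x := by
  have hA : DifferentiableAt ℝ (fderiv ℝ f) x :=
    (hf.fderiv_right (m := 2) (by norm_num)).differentiableAt two_ne_zero
  have hR := differentiableAt_tangentialCoord (hf.of_le (by norm_num)) hinj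
  have hG := ((differentiableAt_fderiv_fderiv hf).clm_apply hv).clm_apply hw
  exact hG.sub (hA.clm_apply (hR.clm_apply hG))

theorem normalProj_fderiv_normalHessian_apply (hf : ContDiffAt ℝ 3 f x)
    (hinj : Function.Injective (fderiv ℝ f x)) {v w : V → V} (hv : DifferentiableAt ℝ v x)
    (hw : DifferentiableAt ℝ w x) (u : V) :
    normalProj f x (fderiv ℝ (fun z ↦ normalHessian f z (v z) (w z)) x u) =
      normalCubic f x u (v x) (w x)
        + normalHessian f x
            (fderiv ℝ v x u + tangentialCoord f x (fderiv ℝ (fderiv ℝ f) x u (v x))) (w x)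
        + normalHessian f x (v x)
            (fderiv ℝ w x u + tangentialCoord f x (fderiv ℝ (fderiv ℝ f) x u (w x))) := by
  have hA : HasFDerivAt (fderiv ℝ f) (fderiv ℝ (fderiv ℝ f) x) x :=
    ((hf.fderiv_right (m := 2) (by norm_num)).differentiableAt two_ne_zero).hasFDerivAt
  have hR := (differentiableAt_tangentialCoord (hf.of_le (by norm_num)) hinj).hasFDerivAt
  have hG := ((differentiableAt_fderiv_fderiv hf).hasFDerivAt.clm_apply hv.hasFDerivAt).clm_apply
    hw.hasFDerivAt
  have hH : HasFDerivAt (fun z ↦ normalHessian f z (v z) (w z)) _ x :=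
    hG.sub (hA.clm_apply (hR.clm_apply hG))
  have hsymm := fderiv_fderiv_symm (hf.of_le (by norm_num : (2 : WithTop ℕ∞) ≤ 3)) (w x)
  rw [hH.fderiv]
  simp only [add_apply, LinearMap.add_apply, sub_apply, ContinuousLinearMap.comp_apply,
    ContinuousLinearMap.flip_apply, ContinuousLinearMap.coe_coe, map_add, map_sub,
    normalProj_fderiv_apply hinj, normalCubic_apply, normalHessian_apply, hsymm]
  abel

theorem normalProj_fderiv_normalHessian_const (hf : ContDiffAt ℝ 3 f x)
    (hinj : Function.Injective (fderiv ℝ f x)) (u v w : V) :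
    normalProj f x (fderiv ℝ (fun z ↦ normalHessian f z v w) x u) =
      normalCubic f x u v w
        + normalHessian f x (tangentialCoord f x (fderiv ℝ (fderiv ℝ f) x u v)) w
        + normalHessian f x v (tangentialCoord f x (fderiv ℝ (fderiv ℝ f) x u w)) := by
  simpa using normalProj_fderiv_normalHessian_apply hf hinj (differentiableAt_const v)
    (differentiableAt_const w) u

theorem differentiableAt_ambientForm_apply (hf : ContDiffAt ℝ 3 f x)
    (hinj : Function.Injective (fderiv ℝ f x)) (y z : E) :
    DifferentiableAt ℝ (fun t ↦ ambientForm f t y z) x := by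
  have hR := differentiableAt_tangentialCoord (hf.of_le (by norm_num)) hinj
  exact differentiableAt_normalHessian_apply hf hinj (hR.clm_apply (differentiableAt_const y))
    (hR.clm_apply (differentiableAt_const z))

theorem normalProj_fderiv_ambientForm_apply (hf : ContDiffAt ℝ 3 f x)
    (hinj : Function.Injective (fderiv ℝ f x)) (u : V) (y z : E) :
    normalProj f x (fderiv ℝ (fun t ↦ ambientForm f t y z) x u) =
      normalCubic f x u (tangentialCoord f x y) (tangentialCoord f x z)
        + normalHessian f x (fderiv ℝ (tangentialCoord f) x u y + tangentialCoord f x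
            (fderiv ℝ (fderiv ℝ f) x u (tangentialCoord f x y))) (tangentialCoord f x z)
        + normalHessian f x (tangentialCoord f x y) (fderiv ℝ (tangentialCoord f) x u z
            + tangentialCoord f x (fderiv ℝ (fderiv ℝ f) x u (tangentialCoord f x z))) := by
  have hR := (differentiableAt_tangentialCoord (hf.of_le (by norm_num)) hinj).hasFDerivAt
  have hR' (y : E) : HasFDerivAt (fun t ↦ tangentialCoord f t y)
      ((fderiv ℝ (tangentialCoord f) x).flip y) x := by
    simpa using hR.clm_apply (hasFDerivAt_const y x)
  simpa [ambientForm_apply, (hR' _).fderiv] using normalProj_fderiv_normalHessian_apply hf hinj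
    (hR' y).differentiableAt (hR' z).differentiableAt u

theorem normalProj_fderiv_ambientForm_of_tangent (hf : ContDiffAt ℝ 3 f x)
    (hinj : Function.Injective (fderiv ℝ f x)) (u v w : V) :
    normalProj f x (fderiv ℝ (fun t ↦ ambientForm f t (fderiv ℝ f x v) (fderiv ℝ f x w)) x u) =
      normalCubic f x u v w := by
  simp [normalProj_fderiv_ambientForm_apply hf hinj, tangentialCoord_fderiv_apply hinj,
    fderiv_tangentialCoord_apply (hf.of_le (by norm_num)) hinj]

theorem normalProj_fderiv_ambientForm_self_of_normal (hf : ContDiffAt ℝ 3 f x)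
    (hinj : Function.Injective (fderiv ℝ f x)) (u : V) {y : E}
    (hy : y ∈ (LinearMap.range (fderiv ℝ f x).toLinearMap)ᗮ) :
    normalProj f x (fderiv ℝ (fun t ↦ ambientForm f t y y) x u) = 0 := by
  simp [normalProj_fderiv_ambientForm_apply hf hinj, tangentialCoord_eq_zero hy]

theorem inner_ambientForm_fderiv_ambientForm (hf : ContDiffAt ℝ 3 f x)
    (hinj : Function.Injective (fderiv ℝ f x)) (u v w : V) :
    ⟪ambientForm f x (fderiv ℝ f x v) (fderiv ℝ f x w),
        fderiv ℝ (fun t ↦ ambientForm f t (fderiv ℝ f x v) (fderiv ℝ f x w)) x u⟫ =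
      ⟪normalHessian f x v w, normalCubic f x u v w⟫ := by
  rw [← normalProj_fderiv_ambientForm_of_tangent hf hinj, ambientForm_apply,
    tangentialCoord_fderiv_apply hinj, tangentialCoord_fderiv_apply hinj,
    inner_normalProj_right hinj (normalProj_normalHessian hinj v w)]

variable [FiniteDimensional ℝ E] {ι : Type*} [Fintype ι] {U : Submodule ℝ E}

theorem normalProj_fderiv_sum_ambientForm (hf : ContDiffAt ℝ 3 f x)
    (hinj : Function.Injective (fderiv ℝ f x))
    (hU : U = LinearMap.range (fderiv ℝ f x).toLinearMap) (b : OrthonormalBasis ι ℝ U) (u : V) :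
    normalProj f x (fderiv ℝ (fun t ↦ ∑ a, ambientForm f t (adaptedOrthonormalBasis b a)
        (adaptedOrthonormalBasis b a)) x u) =
      ∑ i, normalCubic f x u (tangentialCoord f x (b i)) (tangentialCoord f x (b i)) := by
  subst hU
  rw [fderiv_fun_sum fun a _ ↦ differentiableAt_ambientForm_apply hf hinj _ _, sum_apply, map_sum,
    Fintype.sum_sum_type]
  simp only [adaptedOrthonormalBasis_inl, normalProj_fderiv_ambientForm_self_of_normal hf hinj u
    (adaptedOrthonormalBasis_inr_mem b _), Finset.sum_const_zero, add_zero]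
  refine Finset.sum_congr rfl fun i _ ↦ ?_
  obtain ⟨v, hv : fderiv ℝ f x v = b i⟩ := (b i).2
  rw [← hv, normalProj_fderiv_ambientForm_of_tangent hf hinj, tangentialCoord_fderiv_apply hinj]

theorem fderiv_sum_norm_sq_ambientForm (hf : ContDiffAt ℝ 3 f x)
    (hinj : Function.Injective (fderiv ℝ f x))
    (hU : U = LinearMap.range (fderiv ℝ f x).toLinearMap) (b : OrthonormalBasis ι ℝ U) (u : V) :
    fderiv ℝ (fun t ↦ ∑ a, ∑ c, ‖ambientForm f t (adaptedOrthonormalBasis b a)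
        (adaptedOrthonormalBasis b c)‖ ^ 2) x u =
      2 * ∑ i, ∑ j, ⟪normalHessian f x (tangentialCoord f x (b i)) (tangentialCoord f x (b j)),
        normalCubic f x u (tangentialCoord f x (b i)) (tangentialCoord f x (b j))⟫ := by
  subst hU
  set e := adaptedOrthonormalBasis b
  have hβ (a c) := (differentiableAt_ambientForm_apply hf hinj (e a) (e c)).hasFDerivAt
  rw [(HasFDerivAt.fun_sum fun a _ ↦ HasFDerivAt.fun_sum fun c _ ↦ (hβ a c).norm_sq).fderiv]
  have hinr (j) : tangentialCoord f x (e (Sum.inr j)) = 0 :=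
    tangentialCoord_eq_zero (adaptedOrthonormalBasis_inr_mem b j)
  have hinl (i j) := inner_ambientForm_fderiv_ambientForm hf hinj u
    (tangentialCoord f x (b i)) (tangentialCoord f x (b j))
  have hb (i) : fderiv ℝ f x (tangentialCoord f x (b i)) = b i := by
    rw [tangentialCoord, ← starProjection_range_eq hinj,
      Submodule.starProjection_eq_self_iff.2 (b i).2]
  simp only [hb] at hinl
  simp [Fintype.sum_sum_type, ambientForm_apply _ (e (Sum.inr _)),
    ambientForm_apply (e (Sum.inr _)), hinr, e, adaptedOrthonormalBasis_inl, hinl, Finset.mul_sum]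

end Parametrized

/-! ### Derivatives in charts -/

section Charts

variable {𝕜 E H M W : Type*} [NontriviallyNormedField 𝕜] [NormedAddCommGroup E] [NormedSpace 𝕜 E]
  [TopologicalSpace H] {I : ModelWithCorners 𝕜 E H} [TopologicalSpace M] [ChartedSpace H M]
  [NormedAddCommGroup W] [NormedSpace 𝕜 W] {p q : M}

variable (I) in
/-- The differential at `q` of the preferred extended chart at `p`. -/
noncomputable def chartDiff (p q : M) : TangentSpace I q →L[𝕜] E :=
  mvfderiv I (extChartAt I p) q

theorem eventually_mem_chart_source (hq : q ∈ (chartAt H p).source) :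
    ∀ᶠ q' in nhds q, q' ∈ (chartAt H p).source :=
  (chartAt H p).open_source.mem_nhds hq

theorem extChartAt_symm_apply_self (hq : q ∈ (chartAt H p).source) :
    (extChartAt I p).symm (extChartAt I p q) = q :=
  (extChartAt I p).left_inv (by rwa [extChartAt_source])

theorem comp_extChartAt_symm_apply (hq : q ∈ (chartAt H p).source) {X : Type*} (g : M → X) :
    (g ∘ (extChartAt I p).symm) (extChartAt I p q) = g q :=
  congrArg g (extChartAt_symm_apply_self hq)

theorem eventuallyEq_comp_extChartAt (hq : q ∈ (chartAt H p).source) {X : Type*} (g : M → X) :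
    g =ᶠ[nhds q] (g ∘ (extChartAt I p).symm) ∘ extChartAt I p := by
  filter_upwards [eventually_mem_chart_source hq] with q' hq'
    using (comp_extChartAt_symm_apply hq' g).symm

section

variable [IsManifold I 1 M] {g : M → W} {h : E → W}

theorem mdifferentiableAt_of_eventuallyEq_comp_extChartAt (hq : q ∈ (chartAt H p).source)
    (hh : DifferentiableAt 𝕜 h (extChartAt I p q)) (hg : g =ᶠ[nhds q] h ∘ extChartAt I p) :
    MDifferentiableAt I 𝓘(𝕜, W) g q :=
  (hh.mdifferentiableAt.comp q (mdifferentiableAt_extChartAt hq)).congr_of_eventuallyEq hg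

theorem mvfderiv_apply_of_eventuallyEq_comp_extChartAt (hq : q ∈ (chartAt H p).source)
    (hh : DifferentiableAt 𝕜 h (extChartAt I p q)) (hg : g =ᶠ[nhds q] h ∘ extChartAt I p)
    (u : TangentSpace I q) :
    mvfderiv I g q u = fderiv 𝕜 h (extChartAt I p q) (chartDiff I p q u) := by
  have hderiv := ((hh.mdifferentiableAt.hasMFDerivAt.comp q
    (mdifferentiableAt_extChartAt (I := I) hq).hasMFDerivAt).congr_of_eventuallyEq hg).mfderiv
  rw [mfderiv_eq_fderiv] at hderiv
  exact DFunLike.congr_fun hderiv u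

end

theorem contMDiffAt_extChartAt_symm {k : WithTop ℕ∞} [IsManifold I k M] [I.Boundaryless]
    (hq : q ∈ (chartAt H p).source) :
    ContMDiffAt 𝓘(𝕜, E) I k (extChartAt I p).symm (extChartAt I p q) :=
  (contMDiffOn_extChartAt_symm p).contMDiffAt ((isOpen_extChartAt_target p).mem_nhds
    ((extChartAt I p).map_source (by rwa [extChartAt_source])))

section

variable [IsManifold I 1 M]

theorem differentiableAt_comp_extChartAt_symm [I.Boundaryless] (hq : q ∈ (chartAt H p).source)
    {g : M → W} (hg : MDifferentiableAt I 𝓘(𝕜, W) g q) :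
    DifferentiableAt 𝕜 (g ∘ (extChartAt I p).symm) (extChartAt I p q) := by
  rw [← mdifferentiableAt_iff_differentiableAt]
  refine MDifferentiableAt.comp (I' := I) _ ?_
    ((contMDiffAt_extChartAt_symm (k := 1) hq).mdifferentiableAt one_ne_zero)
  rwa [extChartAt_symm_apply_self hq]

theorem chartDiff_apply (hq : q ∈ (chartAt H p).source) (u : TangentSpace I q) :
    chartDiff I p q u = (trivializationAt E (TangentSpace I) p ⟨q, u⟩).2 := by
  have hmem : q ∈ (trivializationAt E (TangentSpace I) p).baseSet := by
    rwa [TangentBundle.trivializationAt_baseSet]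
  have hdiff : chartDiff I p q =
      (trivializationAt E (TangentSpace I) p).continuousLinearMapAt 𝕜 q :=
    (TangentBundle.continuousLinearMapAt_trivializationAt hq).symm
  rw [hdiff, Bundle.Trivialization.continuousLinearMapAt_apply,
    Bundle.Trivialization.coe_linearMapAt_of_mem _ hmem]

theorem chartDiff_bijective (hq : q ∈ (chartAt H p).source) :
    Function.Bijective (chartDiff I p q) := by
  obtain ⟨L, hL⟩ := isInvertible_mfderiv_extChartAt (I := I) (x := p) (y := q)
    (by rwa [extChartAt_source])
  rw [show ⇑(chartDiff I p q) = L from funext fun u ↦ (DFunLike.congr_fun hL u).symm]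
  exact L.bijective

theorem chartDiff_extend (w : TangentSpace I p) (hq : q ∈ (chartAt H p).source) :
    chartDiff I p q (FiberBundle.extend E w q) = chartDiff I p p w := by
  rw [chartDiff_apply hq, chartDiff_apply (mem_chart_source _ p), FiberBundle.extend,
    Bundle.Trivialization.apply_mk_symm]
  rwa [TangentBundle.trivializationAt_baseSet]

end

theorem mdifferentiableAt_chartDiff_extend [IsManifold I 2 M] (w : TangentSpace I q)
    (hq : q ∈ (chartAt H p).source) :
    MDifferentiableAt I 𝓘(𝕜, E) (fun q' ↦ chartDiff I p q' (FiberBundle.extend E w q')) q := by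
  have hextend := FiberBundle.mdifferentiableAt_extend I E w
  rw [Bundle.Trivialization.mdifferentiableAt_section_iff I
    (trivializationAt E (TangentSpace I) p) _
    (by rwa [TangentBundle.trivializationAt_baseSet])] at hextend
  refine hextend.congr_of_eventuallyEq ?_
  filter_upwards [eventually_mem_chart_source hq] with q' hq' using chartDiff_apply hq' _

end Charts

/-! ### Immersed submanifolds in charts -/

namespace ImmersedSubmanifold

open scoped RealInnerProductSpace

variable {n m : ℕ} {M : Type*} [TopologicalSpace M] [ChartedSpace (EuclideanSpace ℝ (Fin n)) M]
  (S : ImmersedSubmanifold n m M) {p q : M}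

theorem dF_tangentialPart (y : EuclideanSpace ℝ (Fin (m + n))) :
    S.dF q (S.tangentialPart q y) = (S.tangentPlane q).starProjection y :=
  congrArg Subtype.val ((S.tangentEquiv q).apply_symm_apply _)

/-- The orthonormal basis of the tangent plane which is the image of `S.frame q`. -/
noncomputable def planeBasis (q : M) : OrthonormalBasis (Fin n) ℝ (S.tangentPlane q) :=
  (stdOrthonormalBasis ℝ (S.tangentPlane q)).reindex (finCongr (S.finrank_tangentPlane q))

theorem tangentEquiv_frame (i : Fin n) : S.tangentEquiv q (S.frame q i) = S.planeBasis q i :=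
  (S.tangentEquiv q).apply_symm_apply _

theorem dF_frame (i : Fin n) : S.dF q (S.frame q i) = S.planeBasis q i :=
  congrArg Subtype.val (S.tangentEquiv_frame i)

/-- The immersion read in the preferred chart at `p`. -/
noncomputable def localMap (p : M) : EuclideanSpace ℝ (Fin n) → EuclideanSpace ℝ (Fin (m + n)) :=
  S.toFun ∘ (extChartAt (𝓡 n) p).symm

variable [IsManifold (𝓡 n) ∞ M]

theorem contDiffAt_localMap (hq : q ∈ (chartAt (EuclideanSpace ℝ (Fin n)) p).source) :
    ContDiffAt ℝ 3 (S.localMap p) (extChartAt (𝓡 n) p q) :=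
  (S.contMDiff.contMDiffAt.comp _ (contMDiffAt_extChartAt_symm hq)).contDiffAt.of_le
    (by norm_cast)

theorem dF_eq (hq : q ∈ (chartAt (EuclideanSpace ℝ (Fin n)) p).source)
    (u : TangentSpace (𝓡 n) q) :
    S.dF q u = fderiv ℝ (S.localMap p) (extChartAt (𝓡 n) p q) (chartDiff (𝓡 n) p q u) :=
  mvfderiv_apply_of_eventuallyEq_comp_extChartAt hq
    ((S.contDiffAt_localMap hq).differentiableAt three_ne_zero)
    (eventuallyEq_comp_extChartAt hq S.toFun) u

theorem injective_fderiv_localMap (hq : q ∈ (chartAt (EuclideanSpace ℝ (Fin n)) p).source) :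
    Function.Injective (fderiv ℝ (S.localMap p) (extChartAt (𝓡 n) p q)) := by
  intro v w h
  obtain ⟨v, rfl⟩ := (chartDiff_bijective (I := 𝓡 n) hq).2 v
  obtain ⟨w, rfl⟩ := (chartDiff_bijective (I := 𝓡 n) hq).2 w
  rw [← S.dF_eq hq, ← S.dF_eq hq] at h
  rw [S.injective_deriv q h]

theorem tangentPlane_eq (hq : q ∈ (chartAt (EuclideanSpace ℝ (Fin n)) p).source) :
    S.tangentPlane q =
      LinearMap.range (fderiv ℝ (S.localMap p) (extChartAt (𝓡 n) p q)).toLinearMap := by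
  ext y
  constructor
  · rintro ⟨u, rfl⟩
    exact ⟨chartDiff (𝓡 n) p q u, (S.dF_eq hq u).symm⟩
  · rintro ⟨v, rfl⟩
    obtain ⟨u, rfl⟩ := (chartDiff_bijective (I := 𝓡 n) hq).2 v
    exact ⟨u, S.dF_eq hq u⟩

theorem normalPart_eq (hq : q ∈ (chartAt (EuclideanSpace ℝ (Fin n)) p).source)
    (y : EuclideanSpace ℝ (Fin (m + n))) :
    S.normalPart q y = normalProj (S.localMap p) (extChartAt (𝓡 n) p q) y := by
  rw [normalPart, normalProj_eq_starProjection (S.injective_fderiv_localMap hq)]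
  simp only [S.tangentPlane_eq hq]

theorem tangentialCoord_dF (hq : q ∈ (chartAt (EuclideanSpace ℝ (Fin n)) p).source)
    (u : TangentSpace (𝓡 n) q) :
    tangentialCoord (S.localMap p) (extChartAt (𝓡 n) p q) (S.dF q u) =
      chartDiff (𝓡 n) p q u := by
  rw [S.dF_eq hq, tangentialCoord_fderiv_apply (S.injective_fderiv_localMap hq)]

theorem tangentialCoord_planeBasis (hq : q ∈ (chartAt (EuclideanSpace ℝ (Fin n)) p).source)
    (i : Fin n) :
    tangentialCoord (S.localMap p) (extChartAt (𝓡 n) p q) (S.planeBasis q i) =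
      chartDiff (𝓡 n) p q (S.frame q i) := by
  rw [← S.dF_frame, S.tangentialCoord_dF hq]

theorem chartDiff_tangentialPart (hq : q ∈ (chartAt (EuclideanSpace ℝ (Fin n)) p).source)
    (y : EuclideanSpace ℝ (Fin (m + n))) :
    chartDiff (𝓡 n) p q (S.tangentialPart q y) =
      tangentialCoord (S.localMap p) (extChartAt (𝓡 n) p q) y := by
  apply S.injective_fderiv_localMap hq
  rw [← S.dF_eq hq, S.dF_tangentialPart, tangentialCoord,
    ← starProjection_range_eq (S.injective_fderiv_localMap hq)]
  simp only [S.tangentPlane_eq hq]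

theorem ambientDeriv_eq (hq : q ∈ (chartAt (EuclideanSpace ℝ (Fin n)) p).source)
    {Y : (q : M) → TangentSpace (𝓡 n) q}
    (hY : MDifferentiableAt (𝓡 n) 𝓘(ℝ, EuclideanSpace ℝ (Fin n))
      (fun q' ↦ chartDiff (𝓡 n) p q' (Y q')) q) (u : TangentSpace (𝓡 n) q) :
    S.ambientDeriv Y q u =
      fderiv ℝ (fderiv ℝ (S.localMap p)) (extChartAt (𝓡 n) p q) (chartDiff (𝓡 n) p q u)
        (chartDiff (𝓡 n) p q (Y q)) +
      fderiv ℝ (S.localMap p) (extChartAt (𝓡 n) p q)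
        (mvfderiv (𝓡 n) (fun q' ↦ chartDiff (𝓡 n) p q' (Y q')) q u) := by
  have hA := ((S.contDiffAt_localMap hq).fderiv_right (m := 2) (by norm_num)).differentiableAt
    two_ne_zero
  have hY' := differentiableAt_comp_extChartAt_symm hq hY
  have hAY := hA.hasFDerivAt.clm_apply hY'.hasFDerivAt
  have hdF : (fun q' ↦ S.dF q' (Y q')) =ᶠ[nhds q]
      (fun z ↦ fderiv ℝ (S.localMap p) z (((fun q' ↦ chartDiff (𝓡 n) p q' (Y q')) ∘
        (extChartAt (𝓡 n) p).symm) z)) ∘ extChartAt (𝓡 n) p := by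
    filter_upwards [eventually_mem_chart_source hq] with q' hq'
    rw [Function.comp_apply, comp_extChartAt_symm_apply hq', S.dF_eq hq']
  rw [ambientDeriv, mvfderiv_apply_of_eventuallyEq_comp_extChartAt hq hAY.differentiableAt hdF,
    hAY.fderiv, mvfderiv_apply_of_eventuallyEq_comp_extChartAt hq hY'
      (eventuallyEq_comp_extChartAt hq _), comp_extChartAt_symm_apply hq]
  exact add_comm _ _

theorem extendVector_self (w : TangentSpace (𝓡 n) p) : extendVector w p = w :=
  FiberBundle.extend_apply_self _ w

theorem secondFundamentalForm_eq (hq : q ∈ (chartAt (EuclideanSpace ℝ (Fin n)) p).source)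
    (u w : TangentSpace (𝓡 n) q) :
    S.secondFundamentalForm q u w = normalHessian (S.localMap p) (extChartAt (𝓡 n) p q)
      (chartDiff (𝓡 n) p q u) (chartDiff (𝓡 n) p q w) := by
  rw [secondFundamentalForm, S.normalPart_eq hq,
    S.ambientDeriv_eq (Y := extendVector w) hq (mdifferentiableAt_chartDiff_extend w hq), map_add,
    normalProj_fderiv_apply (S.injective_fderiv_localMap hq), add_zero, extendVector_self,
    normalHessian_apply]

theorem ambientDeriv_extendVector (u w : TangentSpace (𝓡 n) p) :
    S.ambientDeriv (extendVector w) p u =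
      fderiv ℝ (fderiv ℝ (S.localMap p)) (extChartAt (𝓡 n) p p) (chartDiff (𝓡 n) p p u)
        (chartDiff (𝓡 n) p p w) := by
  have hp := mem_chart_source (EuclideanSpace ℝ (Fin n)) p
  have hconst : (fun q' ↦ chartDiff (𝓡 n) p q' (extendVector w q')) =ᶠ[nhds p]
      (fun _ ↦ chartDiff (𝓡 n) p p w) ∘ extChartAt (𝓡 n) p := by
    filter_upwards [eventually_mem_chart_source hp] with q' hq' using chartDiff_extend w hq'
  rw [S.ambientDeriv_eq (Y := extendVector w) hp (mdifferentiableAt_chartDiff_extend w hp),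
    extendVector_self,
    mvfderiv_apply_of_eventuallyEq_comp_extChartAt hp (differentiableAt_const _) hconst]
  simp

theorem nablaB_eq (u v w : TangentSpace (𝓡 n) p) :
    S.nablaB p u v w = normalCubic (S.localMap p) (extChartAt (𝓡 n) p p)
      (chartDiff (𝓡 n) p p u) (chartDiff (𝓡 n) p p v) (chartDiff (𝓡 n) p p w) := by
  have hp := mem_chart_source (EuclideanSpace ℝ (Fin n)) p
  have hB : (fun q ↦ S.secondFundamentalForm q (extendVector v q) (extendVector w q)) =ᶠ[nhds p]
      (fun z ↦ normalHessian (S.localMap p) z (chartDiff (𝓡 n) p p v) (chartDiff (𝓡 n) p p w)) ∘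
        extChartAt (𝓡 n) p := by
    filter_upwards [eventually_mem_chart_source hp] with q hq
    rw [S.secondFundamentalForm_eq hq, extendVector, extendVector, chartDiff_extend v hq,
      chartDiff_extend w hq, Function.comp_apply]
  rw [nablaB, normalConnection, S.normalPart_eq hp,
    mvfderiv_apply_of_eventuallyEq_comp_extChartAt hp (differentiableAt_normalHessian_apply
      (S.contDiffAt_localMap hp) (S.injective_fderiv_localMap hp) (differentiableAt_const _)
      (differentiableAt_const _)) hB,
    normalProj_fderiv_normalHessian_const (S.contDiffAt_localMap hp)
      (S.injective_fderiv_localMap hp),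
    S.secondFundamentalForm_eq hp, S.secondFundamentalForm_eq hp, tangentConnection,
    tangentConnection, S.chartDiff_tangentialPart hp, S.chartDiff_tangentialPart hp,
    S.ambientDeriv_extendVector, S.ambientDeriv_extendVector]
  abel

/-- The covariant derivative of the second fundamental form, as a trilinear map on the tangent
plane. -/
noncomputable def nablaBForm (p : M) : S.tangentPlane p →ₗ[ℝ] S.tangentPlane p →ₗ[ℝ]
    S.tangentPlane p →ₗ[ℝ] EuclideanSpace ℝ (Fin (m + n)) :=
  let L := (tangentialCoord (S.localMap p) (extChartAt (𝓡 n) p p)).toLinearMap ∘ₗ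
    (S.tangentPlane p).subtype
  ((normalCubic (S.localMap p) (extChartAt (𝓡 n) p p)).compl₁₂ L L).compr₂ (LinearMap.lcomp ℝ _ L)

theorem nablaBForm_tangentEquiv (u v w : TangentSpace (𝓡 n) p) :
    S.nablaBForm p (S.tangentEquiv p u) (S.tangentEquiv p v) (S.tangentEquiv p w) =
      S.nablaB p u v w := by
  have hp := mem_chart_source (EuclideanSpace ℝ (Fin n)) p
  rw [S.nablaB_eq, ← S.tangentialCoord_dF hp, ← S.tangentialCoord_dF hp,
    ← S.tangentialCoord_dF hp]
  rfl

theorem nablaBForm_swap_left (u v w : S.tangentPlane p) :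
    S.nablaBForm p u v w = S.nablaBForm p v u w :=
  normalCubic_swap_left (S.contDiffAt_localMap (mem_chart_source _ p)) _ _ _

theorem nablaBForm_swap_right (u v w : S.tangentPlane p) :
    S.nablaBForm p u v w = S.nablaBForm p u w v :=
  normalCubic_swap_right (S.contDiffAt_localMap (mem_chart_source _ p)) _ _ _

/-! ### Derivatives of the mean curvature and of the norm of the second fundamental form -/

theorem ambientForm_planeBasis (hq : q ∈ (chartAt (EuclideanSpace ℝ (Fin n)) p).source)
    (i j : Fin n) :
    ambientForm (S.localMap p) (extChartAt (𝓡 n) p q) (S.planeBasis q i) (S.planeBasis q j) =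
      S.secondFundamentalForm q (S.frame q i) (S.frame q j) := by
  rw [S.secondFundamentalForm_eq hq, ambientForm_apply, S.tangentialCoord_planeBasis hq,
    S.tangentialCoord_planeBasis hq]

theorem tangentialCoord_localMap_eq_zero
    (hq : q ∈ (chartAt (EuclideanSpace ℝ (Fin n)) p).source)
    {y : EuclideanSpace ℝ (Fin (m + n))} (hy : y ∈ (S.tangentPlane q)ᗮ) :
    tangentialCoord (S.localMap p) (extChartAt (𝓡 n) p q) y = 0 :=
  tangentialCoord_eq_zero (S.tangentPlane_eq hq ▸ hy)

theorem normB_sq (q : M) :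
    S.normB q ^ 2 = ∑ i, ∑ j, ‖S.secondFundamentalForm q (S.frame q i) (S.frame q j)‖ ^ 2 :=
  Real.sq_sqrt (by positivity)

section

variable {κ : Type*} [Fintype κ] (e : OrthonormalBasis κ ℝ (EuclideanSpace ℝ (Fin (m + n))))

theorem meanCurvature_eq (hq : q ∈ (chartAt (EuclideanSpace ℝ (Fin n)) p).source) :
    S.meanCurvature q =
      ∑ a, ambientForm (S.localMap p) (extChartAt (𝓡 n) p q) (e a) (e a) := by
  rw [sum_apply_self_eq_of_orthogonal (S.planeBasis q) e _ fun y hy ↦ by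
    rw [ambientForm_apply, S.tangentialCoord_localMap_eq_zero hq hy, map_zero], meanCurvature]
  simp only [S.ambientForm_planeBasis hq]

theorem normB_sq_eq (hq : q ∈ (chartAt (EuclideanSpace ℝ (Fin n)) p).source) :
    S.normB q ^ 2 =
      ∑ a, ∑ b, ‖ambientForm (S.localMap p) (extChartAt (𝓡 n) p q) (e a) (e b)‖ ^ 2 := by
  rw [sum_sum_norm_sq_eq_of_orthogonal (S.planeBasis q) e, S.normB_sq]
  · simp only [S.ambientForm_planeBasis hq]
  · intro y hy
    ext1 z
    rw [ambientForm_apply, S.tangentialCoord_localMap_eq_zero hq hy, map_zero]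
    rfl
  · intro z y hy
    rw [ambientForm_apply, S.tangentialCoord_localMap_eq_zero hq hy, map_zero]

end

theorem normalConnection_meanCurvature (u : TangentSpace (𝓡 n) p) :
    S.normalConnection S.meanCurvature p u =
      ∑ i, S.nablaB p u (S.frame p i) (S.frame p i) := by
  have hp := mem_chart_source (EuclideanSpace ℝ (Fin n)) p
  have hf := S.contDiffAt_localMap hp
  have hinj := S.injective_fderiv_localMap hp
  have hH := (eventually_mem_chart_source hp).mono fun q hq ↦
    S.meanCurvature_eq (adaptedOrthonormalBasis (S.planeBasis p)) hq
  rw [normalConnection, S.normalPart_eq hp, mvfderiv_apply_of_eventuallyEq_comp_extChartAt hp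
    (DifferentiableAt.fun_sum fun a _ ↦ differentiableAt_ambientForm_apply hf hinj _ _) hH,
    normalProj_fderiv_sum_ambientForm hf hinj (S.tangentPlane_eq hp)]
  simp only [S.tangentialCoord_planeBasis hp, S.nablaB_eq]

theorem mdifferentiableAt_normB_sq (p : M) :
    MDifferentiableAt (𝓡 n) 𝓘(ℝ, ℝ) (fun q ↦ S.normB q ^ 2) p := by
  have hp := mem_chart_source (EuclideanSpace ℝ (Fin n)) p
  refine mdifferentiableAt_of_eventuallyEq_comp_extChartAt hp
    (DifferentiableAt.fun_sum fun a _ ↦ DifferentiableAt.fun_sum fun b _ ↦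
      (differentiableAt_ambientForm_apply (S.contDiffAt_localMap hp)
        (S.injective_fderiv_localMap hp) _ _).norm_sq ℝ)
    ((eventually_mem_chart_source hp).mono fun q hq ↦
      S.normB_sq_eq (adaptedOrthonormalBasis (S.planeBasis p)) hq)

theorem mvfderiv_normB_sq (u : TangentSpace (𝓡 n) p) :
    mvfderiv (𝓡 n) (fun q ↦ S.normB q ^ 2) p u =
      2 * ∑ i, ∑ j, ⟪S.secondFundamentalForm p (S.frame p i) (S.frame p j),
        S.nablaB p u (S.frame p i) (S.frame p j)⟫ := by
  have hp := mem_chart_source (EuclideanSpace ℝ (Fin n)) p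
  have hf := S.contDiffAt_localMap hp
  have hinj := S.injective_fderiv_localMap hp
  have hB := (eventually_mem_chart_source hp).mono fun q hq ↦
    S.normB_sq_eq (adaptedOrthonormalBasis (S.planeBasis p)) hq
  rw [mvfderiv_apply_of_eventuallyEq_comp_extChartAt hp (DifferentiableAt.fun_sum fun a _ ↦
      DifferentiableAt.fun_sum fun b _ ↦
        (differentiableAt_ambientForm_apply hf hinj _ _).norm_sq ℝ) hB,
    fderiv_sum_norm_sq_ambientForm hf hinj (S.tangentPlane_eq hp)]
  simp only [S.tangentialCoord_planeBasis hp, S.nablaB_eq, S.secondFundamentalForm_eq hp]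

theorem mdifferentiableAt_normB (h : S.normB p ≠ 0) :
    MDifferentiableAt (𝓡 n) 𝓘(ℝ, ℝ) S.normB p := by
  have hsqrt : MDifferentiableAt 𝓘(ℝ, ℝ) 𝓘(ℝ, ℝ) Real.sqrt (S.normB p ^ 2) :=
    (differentiableAt_id.sqrt (pow_ne_zero 2 h)).mdifferentiableAt
  refine (hsqrt.comp p (S.mdifferentiableAt_normB_sq p)).congr_of_eventuallyEq
    (.of_forall fun q ↦ ?_)
  exact (Real.sqrt_sq (Real.sqrt_nonneg _)).symm

/-! ### The refined Kato inequality -/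

theorem normB_mul_mvfderiv_normB (h : MDifferentiableAt (𝓡 n) 𝓘(ℝ, ℝ) S.normB p)
    (u : TangentSpace (𝓡 n) p) :
    S.normB p * mvfderiv (𝓡 n) S.normB p u =
      ∑ i, ∑ j, ⟪S.secondFundamentalForm p (S.frame p i) (S.frame p j),
        S.nablaB p u (S.frame p i) (S.frame p j)⟫ := by
  have hsq := S.mvfderiv_normB_sq u
  rw [show (fun q ↦ S.normB q ^ 2) = S.normB * S.normB from funext fun q ↦ sq _,
    mvfderiv_mul h h] at hsq
  have hmul : S.normB p * mvfderiv (𝓡 n) S.normB p u + S.normB p * mvfderiv (𝓡 n) S.normB p u =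
      _ := hsq
  linarith

theorem mvfderiv_normB_eq_zero (h : MDifferentiableAt (𝓡 n) 𝓘(ℝ, ℝ) S.normB p)
    (h0 : S.normB p = 0) (u : TangentSpace (𝓡 n) p) : mvfderiv (𝓡 n) S.normB p u = 0 := by
  have hp := mem_chart_source (EuclideanSpace ℝ (Fin n)) p
  have hmin : IsLocalMin (S.normB ∘ (extChartAt (𝓡 n) p).symm) (extChartAt (𝓡 n) p p) :=
    .of_forall fun x ↦ by
      rw [comp_extChartAt_symm_apply hp, h0]
      exact Real.sqrt_nonneg _
  rw [mvfderiv_apply_of_eventuallyEq_comp_extChartAt hp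
    (differentiableAt_comp_extChartAt_symm hp h) (eventuallyEq_comp_extChartAt hp S.normB),
    hmin.fderiv_eq_zero, zero_apply]

theorem sq_mvfderiv_normB_le (h : MDifferentiableAt (𝓡 n) 𝓘(ℝ, ℝ) S.normB p)
    (u : TangentSpace (𝓡 n) p) :
    mvfderiv (𝓡 n) S.normB p u ^ 2 ≤
      ∑ i, ∑ j, ‖S.nablaB p u (S.frame p i) (S.frame p j)‖ ^ 2 := by
  rcases eq_or_ne (S.normB p) 0 with h0 | h0
  · rw [S.mvfderiv_normB_eq_zero h h0, sq, mul_zero]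
    positivity
  · refine le_of_mul_le_mul_left ?_ (sq_pos_of_ne_zero h0)
    rw [← mul_pow, S.normB_mul_mvfderiv_normB h, S.normB_sq]
    exact sq_sum_sum_inner_le _ _

theorem normSqGrad_normB_le (hn : 1 ≤ n) {ε : ℝ} (hε : 0 < ε)
    (h : MDifferentiableAt (𝓡 n) 𝓘(ℝ, ℝ) S.normB p) :
    (1 + 2 / ((n : ℝ) + ε)) * S.normSqGrad S.normB p
        - 2 * ((n : ℝ) - 1 + ε) / (ε * ((n : ℝ) + ε)) * S.normSqNablaH p
      ≤ S.normSqNablaB p := by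
  have : Nontrivial (S.tangentPlane p) :=
    Module.nontrivial_of_finrank_pos (R := ℝ) (by rw [S.finrank_tangentPlane]; exact hn)
  have hframe (i : Fin n) : (S.tangentEquiv p).symm (S.planeBasis p i) = S.frame p i := rfl
  have hform (v : S.tangentPlane p) (i j : Fin n) :
      S.nablaBForm p v (S.planeBasis p i) (S.planeBasis p j) =
        S.nablaB p ((S.tangentEquiv p).symm v) (S.frame p i) (S.frame p j) := by
    rw [← S.nablaBForm_tangentEquiv, LinearEquiv.apply_symm_apply, tangentEquiv_frame,
      tangentEquiv_frame]
  have hkato := one_add_two_div_mul_sum_sq_le (S.planeBasis p) S.nablaBForm_swap_left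
    S.nablaBForm_swap_right hε
    (l := (mvfderiv (𝓡 n) S.normB p).toLinearMap ∘ₗ (S.tangentEquiv p).symm.toLinearMap)
    fun v ↦ by
      simp only [hform]
      exact S.sq_mvfderiv_normB_le h _
  simp only [hform, hframe, Fintype.card_fin] at hkato
  rw [sub_le_iff_le_add]
  simp only [normSqNablaH, S.normalConnection_meanCurvature]
  exact hkato

theorem normSqGrad_normB_le_of_normSqNablaH_eq_zero (hn : 1 ≤ n)
    (h : MDifferentiableAt (𝓡 n) 𝓘(ℝ, ℝ) S.normB p) (hH : S.normSqNablaH p = 0) :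
    (1 + 2 / (n : ℝ)) * S.normSqGrad S.normB p ≤ S.normSqNablaB p := by
  have hn' : (n : ℝ) + 0 ≠ 0 := by
    rw [add_zero]
    exact_mod_cast (by lia : n ≠ 0)
  have hcont : ContinuousAt (fun ε : ℝ ↦ (1 + 2 / ((n : ℝ) + ε)) * S.normSqGrad S.normB p) 0 := by
    fun_prop (disch := exact hn')
  have hlim := hcont.tendsto.mono_left (nhdsWithin_le_nhds (s := Set.Ioi 0))
  rw [add_zero] at hlim
  refine le_of_tendsto hlim (eventually_nhdsWithin_of_forall fun ε hε ↦ ?_)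
  simpa only [hH, mul_zero, sub_zero] using S.normSqGrad_normB_le hn hε h

theorem normSqNablaH_eq_zero (hH : S.HasParallelMeanCurvature) (p : M) :
    S.normSqNablaH p = 0 := by
  simp [normSqNablaH, hH p]

end ImmersedSubmanifold

theorem lemma2p2 {n m : ℕ} (hn : 1 ≤ n) {M : Type*} [TopologicalSpace M]
    [ChartedSpace (EuclideanSpace ℝ (Fin n)) M] [IsManifold (𝓡 n) ∞ M]
    (S : ImmersedSubmanifold n m M) :
    (∀ p : M, S.normB p ≠ 0 → MDifferentiableAt (𝓡 n) 𝓘(ℝ, ℝ) S.normB p) ∧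
    (∀ ε : ℝ, 0 < ε → ∀ p : M, MDifferentiableAt (𝓡 n) 𝓘(ℝ, ℝ) S.normB p →
      (1 + 2 / ((n : ℝ) + ε)) * S.normSqGrad S.normB p
          - 2 * ((n : ℝ) - 1 + ε) / (ε * ((n : ℝ) + ε)) * S.normSqNablaH p
        ≤ S.normSqNablaB p) ∧
    (S.HasParallelMeanCurvature →
      ∀ p : M, MDifferentiableAt (𝓡 n) 𝓘(ℝ, ℝ) S.normB p →
        (1 + 2 / (n : ℝ)) * S.normSqGrad S.normB p ≤ S.normSqNablaB p) :=
  ⟨fun _ h ↦ S.mdifferentiableAt_normB h, fun _ hε _ h ↦ S.normSqGrad_normB_le hn hε h,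
    fun hH p h ↦ S.normSqGrad_normB_le_of_normSqNablaH_eq_zero hn h (S.normSqNablaH_eq_zero hH p)⟩
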